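/- Let $\Sigma$ be a nonempty finite alphabet. Consider the following decision problem. The input consists of a finite multiset $\mathcal{S}$ of words over $\Sigma$ (given by listing its words, each as often as it occurs), two natural numbers $\ell,u\in\mathbb{N}$ with $\ell\le u\le|\mathcal{S}|$ (given in binary), and a natural number $n$ (given in unary). The question is whether there exists a deterministic finite automaton (DFA) $\mathcal{A}=(Q,\Sigma,q_I,\delta,F)$, with a total transition function $\delta:Q\times\Sigma\to Q$ and exactly $|Q|=n$ states, which accepts at least $\ell$ and at most $u$ words from $\mathcal{S}$, counted with multiplicity. Then this problem lies in $\mathsf{NP}$: there are a nondeterministic (multi-tape) Turing machine $M$ and a polynomial $p$ such that on every input string $x$ every computation of $M$ halts after at most $p(|x|)$ steps, and some computation of $M$ on $x$ accepts if and only if $x$ encodes an instance $(\mathcal{S},\ell,u,n)$ for which such a DFA exists. -/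

import Mathlib

/-! ### Nondeterministic Turing machines and the class NP -/

/-- A nondeterministic multi-tape Turing machine with input alphabet `α`: finitely many two-way
infinite tapes, indexed by `K`, over a common finite tape alphabet `Γ` whose blank symbol is
`default`, a finite set of states, and a finite transition relation. In state `q`, when the
symbols under the heads are given by `s`, a pair `(q', a) ∈ trans q s` allows the machine to go to
state `q'` and, on every tape `k`, to write the symbol `(a k).1` and then to move the head one
cell in the direction `(a k).2` (`none`: the head stays). The machine halts when no transition
is applicable. -/
structure NTM (α : Type) where
  /-- the index set of the tapes -/
  K : Type
  [decEqK : DecidableEq K]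
  [finK : Fintype K]
  /-- the tape that initially holds the input -/
  inputTape : K
  /-- the tape alphabet -/
  Γ : Type
  [finΓ : Fintype Γ]
  [blank : Inhabited Γ]
  /-- the inclusion of the input alphabet into the tape alphabet -/
  inp : α → Γ
  inp_injective : Function.Injective inp
  inp_ne_blank : ∀ a, inp a ≠ default
  /-- the states -/
  State : Type
  [finState : Fintype State]
  /-- the initial state -/
  start : State
  /-- the accepting states -/
  accepting : Set State
  /-- the transition relation -/
  trans : State → (K → Γ) → Set (State × (K → Γ × Option Turing.Dir))

namespace NTM

attribute [instance] NTM.decEqK NTM.finK NTM.finΓ NTM.blank NTM.finState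

variable {α : Type}

/-- A configuration: the current state and the content and head position of every tape. -/
@[ext]
structure Cfg (M : NTM α) where
  /-- the current state -/
  state : M.State
  /-- the tapes -/
  tape : M.K → Turing.Tape M.Γ

/-- Write a symbol in the scanned cell, then move the head (`none`: stay). -/
def act {Γ : Type} [Inhabited Γ] (a : Γ × Option Turing.Dir) (T : Turing.Tape Γ) :
    Turing.Tape Γ :=
  match a.2 with
  | none => T.write a.1
  | some d => (T.write a.1).move d

/-- The initial configuration on input `x`: the input word is on the input tape, with the head on
its first letter, and all the other tapes are blank. -/
def init (M : NTM α) (x : List α) : M.Cfg where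
  state := M.start
  tape k := if k = M.inputTape then Turing.Tape.mk₁ (x.map M.inp) else Turing.Tape.mk₁ []

/-- `M.Step c c'`: the machine can go from `c` to `c'` in one step. -/
def Step (M : NTM α) (c c' : M.Cfg) : Prop :=
  ∃ a : M.K → M.Γ × Option Turing.Dir,
    (c'.state, a) ∈ M.trans c.state (fun k => (c.tape k).head) ∧
      ∀ k, c'.tape k = act (a k) (c.tape k)

/-- `M.StepsTo t c c'`: some computation of exactly `t` steps leads from `c` to `c'`. -/
inductive StepsTo (M : NTM α) : ℕ → M.Cfg → M.Cfg → Prop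
  | refl (c : M.Cfg) : StepsTo M 0 c c
  | tail {t : ℕ} {c c' c'' : M.Cfg} : StepsTo M t c c' → M.Step c' c'' → StepsTo M (t + 1) c c''

/-- A configuration is halting if it has no successor. -/
def Halted (M : NTM α) (c : M.Cfg) : Prop :=
  ∀ c', ¬ M.Step c c'

/-- The machine accepts `x` if some computation on input `x` halts in an accepting state. -/
def Accepts (M : NTM α) (x : List α) : Prop :=
  ∃ t c, M.StepsTo t (M.init x) c ∧ M.Halted c ∧ c.state ∈ M.accepting

/-- Every computation of the machine on input `x`, whatever the nondeterministic choices, has at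
most `b` steps. -/
def RunsWithin (M : NTM α) (x : List α) (b : ℕ) : Prop :=
  ∀ t c, M.StepsTo t (M.init x) c → t ≤ b

/-- `M` decides the language `L` in polynomial time: on every input word all computations halt
within a number of steps that is polynomial in the length of the word, and exactly the words
of `L` are accepted. -/
def DecidesInPolyTime (M : NTM α) (L : Language α) : Prop :=
  ∃ p : Polynomial ℕ, ∀ x : List α,
    M.RunsWithin x (p.eval x.length) ∧ (M.Accepts x ↔ x ∈ L)

end NTM

/-- The class NP: the languages decided by a nondeterministic Turing machine in polynomial
time. -/
def InNP {α : Type} (L : Language α) : Prop :=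
  ∃ M : NTM α, M.DecidesInPolyTime L

/-! ### The decision version of two-bound DFA learning -/

/-- The number of words (counted with multiplicity) of the sample `S` that `A` accepts. -/
noncomputable def DFA.acceptedCount {α Q : Type} (A : DFA α Q) (S : Multiset (List α)) : ℕ :=
  open Classical in (S.filter (fun w => w ∈ A.accepts)).card

/-- An instance: a finite multiset of words over the alphabet `α`, bounds
`lower ≤ upper ≤ |sample|`, and the prescribed number of states. -/
structure TwoBoundInstance (α : Type) where
  /-- the sample -/
  sample : Multiset (List α)
  /-- the lower bound on the number of accepted words -/
  lower : ℕ
  /-- the upper bound on the number of accepted words -/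
  upper : ℕ
  /-- the number of states -/
  states : ℕ
  lower_le_upper : lower ≤ upper
  upper_le_card : upper ≤ sample.card

/-- The question: is there a DFA with exactly `I.states` states that accepts at least `I.lower`
and at most `I.upper` words from the sample? -/
def TwoBoundInstance.IsYes {α : Type} (I : TwoBoundInstance α) : Prop :=
  ∃ (Q : Type) (_ : Fintype Q) (A : DFA α Q), Fintype.card Q = I.states ∧
    I.lower ≤ A.acceptedCount I.sample ∧ A.acceptedCount I.sample ≤ I.upper

/-- The input symbols with which instances over the alphabet `α` are written down. -/
inductive InstSymbol (α : Type)
  /-- the unary digit -/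
  | tick
  /-- a binary digit -/
  | bit (b : Bool)
  /-- a letter of a word of the sample -/
  | letter (a : α)
  /-- the end marker of a number or of a word -/
  | sep

/-- `n` in unary, `l` and `u` in binary (`Computability.encodeNat`: least significant bit first,
without superfluous zeros), followed by all the words, each one written out once per occurrence;
each of these blocks is followed by an end marker. -/
def encodeTwoBound {α : Type} (ws : List (List α)) (l u n : ℕ) : List (InstSymbol α) :=
  List.replicate n InstSymbol.tick ++ [InstSymbol.sep] ++
    (Computability.encodeNat l).map InstSymbol.bit ++ [InstSymbol.sep] ++
    (Computability.encodeNat u).map InstSymbol.bit ++ [InstSymbol.sep] ++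
    ws.flatMap (fun w => w.map InstSymbol.letter ++ [InstSymbol.sep])

/-- The string `x` encodes the instance `I`: the words of the sample may be listed in any
order. -/
def TwoBoundInstance.EncodedBy {α : Type} (I : TwoBoundInstance α) (x : List (InstSymbol α)) :
    Prop :=
  ∃ ws : List (List α), (ws : Multiset (List α)) = I.sample ∧
    x = encodeTwoBound ws I.lower I.upper I.states

/-- The decision problem as a language: the strings that encode a yes-instance. -/
def twoBoundDFA (α : Type) : Language (InstSymbol α) :=
  {x | ∃ I : TwoBoundInstance α, I.EncodedBy x ∧ I.IsYes}

/-! Since `n` is given in unary, a table describing an automaton with `n` states has size polynomial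
in the input length, so a machine can guess it and simulate it on every word. Row `q` consists of an
acceptance bit and `n` cells; cell `k` guesses the set of letters leading from `q` to `k`. The guess
need not be consistent: a letter goes to the first cell containing it, and the run gets stuck if
there is none. Such a partial table extends to an automaton (`exists_agrees`); conversely every
automaton has a table (`exists_rows`), and its start state may be renumbered to 0.

The bounds are checked by counting down. Each accepted word decreases `u` and, by a guess, possibly
`l`; each rejected word decreases, by a guess, possibly `u`. A decrement of 0 gets stuck, and both
counters must end at 0. If `c` words are accepted, suitable guesses exist if and only if `l ≤ c ≤ u
≤ |S|`, so the side conditions on an instance are verified along the way (`RunOK.exists_words`,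
`runOK_words`).

The machine is verified backwards. `Spec` records both a time bound for all computations from a
configuration and the condition under which some computation accepts. Each phase lemma transports it
from the end of a phase to its beginning, guesses turning into existential quantifiers. `spec_init`
chains the phases, and `mem_twoBoundDFA_iff` identifies the resulting condition with the language.
-/

namespace NTM

/-! ### Backward reasoning about time and acceptance -/

variable {α : Type} {M : NTM α}

/-- All computations from `c` take at most `b` steps, and some computation from `c` halts in an
accepting state if and only if `A` holds. -/
def Spec (M : NTM α) (c : M.Cfg) (b : ℕ) (A : Prop) : Prop :=
  (∀ t c', M.StepsTo t c c' → t ≤ b) ∧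
    ((∃ t c', M.StepsTo t c c' ∧ M.Halted c' ∧ c'.state ∈ M.accepting) ↔ A)

theorem StepsTo.head {t : ℕ} {c c' c'' : M.Cfg} (h : M.Step c c') (h' : M.StepsTo t c' c'') :
    M.StepsTo (t + 1) c c'' := by
  induction h' with
  | refl => exact .tail (.refl _) h
  | tail _ hs ih => exact .tail (ih h) hs

theorem StepsTo.eq_or_head {t : ℕ} {c c'' : M.Cfg} (h : M.StepsTo t c c'') :
    (t = 0 ∧ c'' = c) ∨ ∃ s c', t = s + 1 ∧ M.Step c c' ∧ M.StepsTo s c' c'' := by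
  induction h with
  | refl => exact .inl ⟨rfl, rfl⟩
  | tail _ hs ih =>
    rcases ih with ⟨rfl, rfl⟩ | ⟨s, d, rfl, hd, hs'⟩
    · exact .inr ⟨0, _, rfl, hs, .refl _⟩
    · exact .inr ⟨s + 1, d, rfl, hd, .tail hs' hs⟩

theorem Spec.mono {c : M.Cfg} {b b' : ℕ} {A A' : Prop} (h : M.Spec c b A) (hb : b ≤ b')
    (hA : A ↔ A') : M.Spec c b' A' :=
  ⟨fun t c' ht => (h.1 t c' ht).trans hb, h.2.trans hA⟩

theorem Spec.of_halted {c : M.Cfg} (b : ℕ) (h : M.Halted c) :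
    M.Spec c b (c.state ∈ M.accepting) := by
  have key : ∀ t c', M.StepsTo t c c' → t = 0 ∧ c' = c := fun t c' ht => by
    rcases ht.eq_or_head with h0 | ⟨s, d, _, hd, _⟩
    · exact h0
    · exact absurd hd (h d)
  refine ⟨fun t c' ht => (key t c' ht).1 ▸ Nat.zero_le _, ⟨?_, fun ha => ⟨0, c, .refl _, h, ha⟩⟩⟩
  rintro ⟨t, c', ht, -, ha⟩
  exact (key t c' ht).2 ▸ ha

/-- The basic backward rule. `hacc` excludes acceptance by the computation of length 0, so every
accepting computation passes through some `f i`. -/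
theorem Spec.of_steps {ι : Type*} {c : M.Cfg} (f : ι → M.Cfg) {b : ℕ} {A : ι → Prop}
    (hacc : c.state ∉ M.accepting) (hf : ∀ c', M.Step c c' ↔ ∃ i, c' = f i)
    (h : ∀ i, M.Spec (f i) b (A i)) : M.Spec c (b + 1) (∃ i, A i) := by
  refine ⟨fun t c' ht => ?_, ?_, ?_⟩
  · rcases ht.eq_or_head with ⟨rfl, -⟩ | ⟨s, d, rfl, hd, hs⟩
    · exact Nat.zero_le _
    · obtain ⟨i, rfl⟩ := (hf d).1 hd
      exact Nat.succ_le_succ ((h i).1 _ _ hs)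
  · rintro ⟨t, c', ht, hh, ha⟩
    rcases ht.eq_or_head with ⟨-, rfl⟩ | ⟨s, d, rfl, hd, hs⟩
    · exact absurd ha hacc
    · obtain ⟨i, rfl⟩ := (hf d).1 hd
      exact ⟨i, (h i).2.1 ⟨s, c', hs, hh, ha⟩⟩
  · rintro ⟨i, hi⟩
    obtain ⟨t, c', ht, hh, ha⟩ := (h i).2.2 hi
    exact ⟨t + 1, c', ht.head ((hf _).2 ⟨i, rfl⟩), hh, ha⟩

end NTM

/-! ### The machine -/

namespace TwoBound

open Turing NTM

/-- The tape alphabet: the blank, the input symbols, the header of a row of the transition table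
(which tells whether the state is accepting), and an entry of the transition table. -/
inductive Sym (α : Type)
  | blank
  | inp (x : InstSymbol α)
  | head (b : Bool)
  | cell (s : Set α)

/-- The tapes. -/
inductive Track
  | input
  | width
  | count
  | table
  | num (t : Bool)
  deriving DecidableEq, Fintype

/-- The control states. -/
inductive Ctrl (α : Type)
  | ticks
  | digits (t last : Bool)
  | row
  | cells
  | back
  | rewind
  | skip
  | skipRow
  | run
  | find (a : α)
  | home (t : Bool) (m : Option Bool)
  | borrow (t : Bool) (m : Option Bool)
  | next (t : Bool) (m : Option Bool)
  | accept
  deriving Fintype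

instance {α : Type} : Inhabited (Sym α) := ⟨.blank⟩

instance {α : Type} [Finite α] : Finite (InstSymbol α) :=
  Finite.of_surjective (α := Option (Option (Bool ⊕ α)))
    (fun x => match x with
      | none => .tick
      | some none => .sep
      | some (some (.inl b)) => .bit b
      | some (some (.inr a)) => .letter a)
    (by
      rintro (_ | b | a | _)
      exacts [⟨none, rfl⟩, ⟨some (some (.inl b)), rfl⟩, ⟨some (some (.inr a)), rfl⟩,
        ⟨some none, rfl⟩])

instance {α : Type} [Finite α] : Finite (Sym α) :=
  Finite.of_surjective (α := Option (InstSymbol α ⊕ Bool ⊕ Set α))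
    (fun x => match x with
      | none => .blank
      | some (.inl x) => .inp x
      | some (.inr (.inl b)) => .head b
      | some (.inr (.inr s)) => .cell s)
    (by
      rintro (_ | x | b | s)
      exacts [⟨none, rfl⟩, ⟨some (.inl x), rfl⟩, ⟨some (.inr (.inl b)), rfl⟩,
        ⟨some (.inr (.inr s)), rfl⟩])

variable {α : Type}

/-- A symbol to be written, and a move. -/
abbrev Act (α : Type) := Sym α × Option Dir

/-- The symbol marking unary numbers. -/
abbrev tk : Sym α := .inp .tick

/-- A binary digit. -/
abbrev dg (b : Bool) : Sym α := .inp (.bit b)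

/-- Assemble a family indexed by the tapes. -/
def tracks {β : Type} (i w c t : β) (b : Bool → β) : Track → β
  | .input => i
  | .width => w
  | .count => c
  | .table => t
  | .num s => b s

/-- Leave the digit tapes unchanged. -/
abbrev keep (b : Bool → Sym α) : Bool → Act α := fun s => (b s, none)

/-- Act on one of the digit tapes only. -/
abbrev on (b : Bool → Sym α) (t : Bool) (a : Act α) : Bool → Act α :=
  Function.update (keep b) t a

/-- The transition relation, in terms of the scanned symbols. -/
def trans (q : Ctrl α) (i w c t : Sym α) (b : Bool → Sym α) :
    Set (Ctrl α × (Track → Act α)) :=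
  match q with
  | .ticks => match i with
    | .inp .tick => {(.ticks, tracks (i, some .right) (tk, some .right) (tk, some .right)
        (t, none) (keep b))}
    | .inp .sep => {(.digits false true, tracks (i, some .right) (w, none) (c, none)
        (t, none) (keep b))}
    | _ => ∅
  -- `l` is the last digit read. It starts as `true`, so that the empty block, which encodes 0, is
  -- admitted.
  | .digits s l => match i with
    | .inp (.bit d) => {(.digits s d, tracks (i, some .right) (w, none) (c, none)
        (t, none) (on b s (dg d, some .right)))}
    | .inp .sep => match s, l with
      | false, true => {(.digits true true, tracks (i, some .right) (w, none) (c, none)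
          (t, none) (keep b))}
      | true, true => {(.row, tracks (i, some .right) (w, none) (c, some .left)
          (t, none) (keep b))}
      | _, false => ∅
    | _ => ∅
  | .row => match c with
    | .inp .tick => Set.range fun d : Bool => (.cells, tracks (i, none) (w, some .left)
        (.blank, none) (.head d, some .right) (keep b))
    | .blank => {(.rewind, tracks (i, none) (w, none) (c, none) (t, some .left) (keep b))}
    | _ => ∅
  | .cells => match w with
    | .inp .tick => Set.range fun s : Set α => (.cells, tracks (i, none) (w, some .left)
        (c, none) (.cell s, some .right) (keep b))
    | .blank => {(.back, tracks (i, none) (w, some .right) (c, none) (t, none) (keep b))}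
    | _ => ∅
  | .back => match w with
    | .inp .tick => {(.back, tracks (i, none) (w, some .right) (c, none) (t, none) (keep b))}
    | .blank => {(.row, tracks (i, none) (w, none) (c, some .left) (t, none) (keep b))}
    | _ => ∅
  | .rewind => match t with
    | .blank => {(.skip, tracks (i, none) (w, none) (c, some .left) (t, some .right) (keep b))}
    | _ => {(.rewind, tracks (i, none) (w, none) (c, none) (t, some .left) (keep b))}
  | .skip => match t, c with
    | .head _, .inp .tick => {(.skipRow, tracks (i, none) (w, none) (.blank, none)
        (t, some .right) (keep b))}
    | .head _, .blank => {(.run, tracks (i, none) (w, none) (c, none) (t, none) (keep b))}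
    | _, _ => ∅
  | .skipRow => match t with
    | .cell _ => {(.skipRow, tracks (i, none) (w, none) (c, none) (t, some .right) (keep b))}
    | _ => {(.skip, tracks (i, none) (w, none) (c, some .left) (t, none) (keep b))}
  | .run => match i with
    | .inp (.letter a) => {(.find a, tracks (i, some .right) (w, none) (c, none)
        (t, some .right) (keep b))}
    | .inp .sep => match t with
      -- The guess `m` decides whether this accepted word also counts towards the lower bound; for a
      -- rejected word, whether the slack of the upper bound is used.
      | .head true => Set.range fun m : Bool => (.home true (some m),
          tracks (i, some .right) (w, none) (c, none) (t, some .left)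
            (on b true (b true, some .left)))
      | .head false => Set.range fun m : Bool => (if m then .home true (some false) else .rewind,
          tracks (i, some .right) (w, none) (c, none) (t, some .left)
            (if m then on b true (b true, some .left) else keep b))
      | _ => ∅
    | .blank => {(.home true none, tracks (i, none) (w, none) (c, none) (t, none)
        (on b true (b true, some .left)))}
    | _ => ∅
  | .find a => match t with
    -- A blank after a letter means that the last word lacks its end marker; without this test,
    -- `run` would take the blank for the regular end of the input.
    | .cell s => {p | (a ∈ s ∧ i ≠ .blank ∧ p = (.rewind, tracks (i, none) (w, none) (c, none)
          (t, some .left) (keep b))) ∨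
        (a ∉ s ∧ p = (.find a, tracks (i, none) (w, none) (tk, some .right)
          (t, some .right) (keep b)))}
    | _ => ∅
  | .home s m => match b s with
    | .blank => {(.borrow s m, tracks (i, none) (w, none) (c, none) (t, none)
        (on b s (b s, some .right)))}
    | _ => {(.home s m, tracks (i, none) (w, none) (c, none) (t, none)
        (on b s (b s, some .left)))}
  | .borrow s m => match b s, m with
    | .inp (.bit false), some _ => {(.borrow s m, tracks (i, none) (w, none) (c, none) (t, none)
        (on b s (dg true, some .right)))}
    | .inp (.bit true), some _ => {(.next s m, tracks (i, none) (w, none) (c, none) (t, none)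
        (on b s (dg false, none)))}
    | .inp (.bit false), none => {(.borrow s m, tracks (i, none) (w, none) (c, none) (t, none)
        (on b s (b s, some .right)))}
    | .blank, none => {(.next s m, tracks (i, none) (w, none) (c, none) (t, none) (keep b))}
    | _, _ => ∅
  | .next s m => match m, s with
    | some true, _ => {(.home false (some false), tracks (i, none) (w, none) (c, none) (t, none)
        (on b false (b false, some .left)))}
    | some false, _ => {(.rewind, tracks (i, none) (w, none) (c, none) (t, none) (keep b))}
    | none, true => {(.home false none, tracks (i, none) (w, none) (c, none) (t, none)
        (on b false (b false, some .left)))}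
    | none, false => {(.accept, tracks (i, none) (w, none) (c, none) (t, none) (keep b))}
  | .accept => ∅

/-! ### Tape operations -/

@[simp] theorem act_keep (T : Tape (Sym α)) : act (T.head, none) T = T := Tape.write_self T

@[simp] theorem act_keep_move (T : Tape (Sym α)) (d : Dir) :
    act (T.head, some d) T = T.move d := by
  simp [act]

theorem act_on (b : Bool → Tape (Sym α)) (t : Bool) (a : Act α) :
    (fun s => act (on (fun s => (b s).head) t a s) (b s)) =
      Function.update b t (act a (b t)) := by
  funext s
  by_cases h : s = t
  · subst h; simp
  · simp [h]

/-- The tape whose cells left of the head are `L` (read leftwards), and whose remaining cells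
are `R`. -/
abbrev tp (L R : List (Sym α)) : Tape (Sym α) := Tape.mk₂ L R

theorem tp_blank (L : List (Sym α)) : tp L [.blank] = tp L [] := rfl

theorem tp_right (L R : List (Sym α)) (a : Sym α) :
    (tp L (a :: R)).move .right = tp (a :: L) R := rfl

theorem tp_left (L R : List (Sym α)) (a : Sym α) :
    (tp (a :: L) R).move .left = tp L (a :: R) := by
  simp [tp, Tape.mk₂]

theorem act_left (L R : List (Sym α)) (a : Sym α) :
    act (a, some .left) (tp L (a :: R)) = (tp L (a :: R)).move .left :=
  act_keep_move (tp L (a :: R)) .left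

theorem tp_push (L : List (Sym α)) (a : Sym α) :
    act (a, some .right) (tp L []) = tp (a :: L) [] := rfl

/-- A unary counter with value 0 is a blank tape, so the move towards its last mark must have no
effect. This holds because trailing blanks are identified in `ListBlank`. -/
theorem tp_blank_left : (tp [] [] : Tape (Sym α)).move .left = tp [] [] := by
  have h : (tp [.blank] [] : Tape (Sym α)) = tp [] [] := by
    have : (ListBlank.mk [.blank] : ListBlank (Sym α)) = ListBlank.mk [] :=
      Quotient.sound (.inr ⟨1, rfl⟩)
    simp only [tp, Tape.mk₂, this]
  rw [← h, tp_left, h, tp_blank]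

theorem tp_erase (L : List (Sym α)) (a : Sym α) :
    act (.blank, none) ((tp (a :: L) []).move .left) = tp L [] := by
  rw [tp_left]; rfl

/-- The machine. -/
noncomputable def machine (α : Type) [Finite α] : NTM (InstSymbol α) :=
  letI := Fintype.ofFinite α
  letI := Fintype.ofFinite (Sym α)
  { K := Track
    inputTape := .input
    Γ := Sym α
    inp := .inp
    inp_injective := fun _ _ h => by injection h
    inp_ne_blank := fun _ h => by injection h
    State := Ctrl α
    start := .ticks
    accepting := {.accept}
    trans := fun q s => trans q (s .input) (s .width) (s .count) (s .table) (fun t => s (.num t)) }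

/-! ### Configurations and one-step rules -/

variable [Finite α]

/-- The configuration with the given state and tapes. -/
def conf (q : Ctrl α) (i w c t : Tape (Sym α)) (b : Bool → Tape (Sym α)) : (machine α).Cfg :=
  ⟨q, (tracks i w c t b : Track → Tape (Sym α))⟩

theorem step_iff {q : Ctrl α} {i w c t : Tape (Sym α)} {b : Bool → Tape (Sym α)}
    {d : (machine α).Cfg} :
    (machine α).Step (conf q i w c t b) d ↔
      ∃ p ∈ trans q i.head w.head c.head t.head (fun s => (b s).head),
        d = ⟨p.1, fun k => act (p.2 k) ((tracks i w c t b : Track → Tape (Sym α)) k)⟩ := by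
  constructor
  · rintro ⟨a, ha, hd⟩
    refine ⟨(d.state, a), ha, ?_⟩
    ext1
    · rfl
    · funext k
      exact hd k
  · rintro ⟨p, hp, rfl⟩
    exact ⟨p.2, hp, fun k => rfl⟩

theorem act_tracks {ai aw ac at' : Act α} {ab : Bool → Act α}
    {q : Ctrl α} {i w c t : Tape (Sym α)} {b : Bool → Tape (Sym α)} :
    (⟨q, fun k => act ((tracks ai aw ac at' ab : Track → Act α) k)
        ((tracks i w c t b : Track → Tape (Sym α)) k)⟩ : (machine α).Cfg) =
      conf q (act ai i) (act aw w) (act ac c) (act at' t) (fun s => act (ab s) (b s)) := by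
  unfold conf
  congr 1
  funext k
  cases k <;> rfl

section Rules

variable {q : Ctrl α} {i w c t : Tape (Sym α)} {b : Bool → Tape (Sym α)} {B : ℕ}

theorem spec_range {ι : Type*} {A : ι → Prop} (q' : ι → Ctrl α) (ai aw ac at' : ι → Act α)
    (ab : ι → Bool → Act α) (hq : q ≠ .accept)
    (ht : trans q i.head w.head c.head t.head (fun s => (b s).head) =
      Set.range fun x => (q' x, tracks (ai x) (aw x) (ac x) (at' x) (ab x)))
    (h : ∀ x, (machine α).Spec (conf (q' x) (act (ai x) i) (act (aw x) w) (act (ac x) c)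
      (act (at' x) t) (fun s => act (ab x s) (b s))) B (A x)) :
    (machine α).Spec (conf q i w c t b) (B + 1) (∃ x, A x) := by
  refine Spec.of_steps _ hq (fun d => ?_) h
  rw [step_iff, ht]
  simp only [Set.exists_range_iff, act_tracks]

theorem spec_one {A : Prop} (q' : Ctrl α) {ai aw ac at' : Act α}
    {ab : Bool → Act α} (hq : q ≠ .accept)
    (ht : trans q i.head w.head c.head t.head (fun s => (b s).head) =
      {(q', tracks ai aw ac at' ab)})
    (h : (machine α).Spec (conf q' (act ai i) (act aw w) (act ac c)
      (act at' t) (fun s => act (ab s) (b s))) B A) :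
    (machine α).Spec (conf q i w c t b) (B + 1) A := by
  refine (spec_range (ι := Unit) (A := fun _ => A) (fun _ => q') (fun _ => ai) (fun _ => aw)
    (fun _ => ac) (fun _ => at') (fun _ => ab) hq ?_ fun _ => h).mono le_rfl (by simp)
  rw [ht, Set.range_const]

theorem spec_none (B : ℕ) (hq : q ≠ .accept)
    (ht : trans q i.head w.head c.head t.head (fun s => (b s).head) = ∅) :
    (machine α).Spec (conf q i w c t b) B False := by
  refine (Spec.of_halted B fun d hd => ?_).mono le_rfl (iff_false_intro hq)
  rw [step_iff, ht] at hd
  simp at hd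

end Rules

end TwoBound

namespace TwoBound

open Turing NTM

variable {α : Type}

theorem trans_find_mem {a : α} {s : Set α} (ha : a ∈ s) {i w c : Sym α} {b : Bool → Sym α}
    (hi : i ≠ .blank) : trans (.find a) i w c (.cell s) b =
      {(.rewind, tracks (i, none) (w, none) (c, none) (.cell s, some .left) (keep b))} := by
  ext p
  simp [trans, ha, hi]

theorem trans_find_blank {a : α} {s : Set α} (ha : a ∈ s) {i w c : Sym α} {b : Bool → Sym α}
    (hi : i = .blank) : trans (.find a) i w c (.cell s) b = ∅ := by
  ext p
  simp [trans, ha, hi]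

theorem trans_find_notMem {a : α} {s : Set α} (ha : a ∉ s) {i w c : Sym α} {b : Bool → Sym α} :
    trans (.find a) i w c (.cell s) b = {(.find a, tracks (i, none) (w, none) (tk, some .right)
      (.cell s, some .right) (keep b))} := by
  ext p
  simp [trans, ha]

variable [Finite α]

/-! ### Reading the numbers and guessing the table -/

section Phases

variable {i w c t : Tape (Sym α)} {b : Bool → Tape (Sym α)} {B : ℕ} {A : Prop}

/-- The rows of the transition table, written on the tape. -/
def flat (rows : List (Bool × List (Set α))) : List (Sym α) :=
  rows.flatMap fun r => .head r.1 :: r.2.map .cell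

/-- A unary number. -/
abbrev un (n : ℕ) : List (Sym α) := List.replicate n tk

/-- The typical shape of a phase lemma: `h` is the specification of the next phase, and `A` depends
on the data just read. `A` has to vary in the induction, because reading one tick shifts its
argument. -/
theorem spec_ticks (x : List (InstSymbol α)) (I : List (Sym α)) (j : ℕ)
    {A : ℕ → List (InstSymbol α) → Prop}
    (h : ∀ k y I, x = List.replicate k .tick ++ .sep :: y →
      (machine α).Spec (conf (.digits false true) (tp I (y.map .inp)) (tp (un (j + k)) [])
        (tp (un (j + k)) []) t b) B (A k y)) :
    (machine α).Spec (conf .ticks (tp I (x.map .inp)) (tp (un j) []) (tp (un j) []) t b)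
      (x.length + B) (∃ k y, x = List.replicate k .tick ++ .sep :: y ∧ A k y) := by
  induction x generalizing I j A with
  | nil =>
    refine (spec_none _ (by nofun) rfl).mono le_rfl ?_
    simp
  | cons a x ih =>
    cases a with
    | bit d =>
      refine (spec_none _ (by nofun) rfl).mono le_rfl ?_
      simp only [false_iff]
      rintro ⟨_ | k, y, hk, -⟩ <;> simp [List.replicate_succ] at hk
    | letter d =>
      refine (spec_none _ (by nofun) rfl).mono le_rfl ?_
      simp only [false_iff]
      rintro ⟨_ | k, y, hk, -⟩ <;> simp [List.replicate_succ] at hk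
    | sep =>
      have := h 0 x (.inp .sep :: I) rfl
      refine (spec_one (.digits false true) (by nofun) rfl ?_).mono
        (b := B + 1) (A := A 0 x) (by simp only [List.length_cons]; omega) ?_
      · simpa [tp_right] using this
      · constructor
        · exact fun h => ⟨0, x, rfl, h⟩
        · rintro ⟨_ | k, y, hk, hA⟩
          · simp at hk; exact hk ▸ hA
          · simp [List.replicate_succ] at hk
    | tick =>
      have := ih (.inp .tick :: I) (j + 1) (A := fun k y => A (k + 1) y) fun k y I hx => by
        have := h (k + 1) y I (by rw [hx]; rfl)
        rwa [show j + (k + 1) = j + 1 + k by omega] at this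
      refine (spec_one .ticks (by nofun) rfl this).mono (by simp only [List.length_cons]; omega) ?_
      constructor
      · rintro ⟨k, y, hx, hA⟩
        exact ⟨k + 1, y, by rw [hx]; rfl, hA⟩
      · rintro ⟨_ | k, y, hk, hA⟩
        · simp at hk
        · exact ⟨k, y, by simpa [List.replicate_succ] using hk, hA⟩

/-- The table contains no blank, so the first blank met on the way left is the cell in front of it.
-/
theorem spec_rewind (L R : List (Sym α)) (hL : ∀ x ∈ L, x ≠ .blank)
    (h : (machine α).Spec (conf .skip i w (c.move .left) (tp [] (L.reverse ++ R)) b) B A) :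
    (machine α).Spec (conf .rewind i w c ((tp L R).move .left) b) (L.length + 1 + B) A := by
  induction L generalizing R with
  | nil =>
    refine (spec_one (B := B) .skip (by nofun) rfl ?_).mono (by simp only [List.length_nil]; omega) Iff.rfl
    simpa using h
  | cons x L ih =>
    have := ih (x :: R) (fun y hy => hL y (by simp [hy])) (by simpa using h)
    rw [tp_left]
    -- The actions are given explicitly, since the transition only reduces after a case distinction
    -- on `x`.
    refine (spec_one (B := L.length + 1 + B) .rewind (ai := (i.head, none)) (aw := (w.head, none))
      (ac := (c.head, none)) (at' := (x, some .left)) (ab := keep fun s => (b s).head)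
      (by nofun) ?_ ?_).mono (by simp only [List.length_cons]; omega) Iff.rfl
    · have hx := hL x (by simp)
      cases x <;> first | rfl | simp at hx
    · simpa [act_left] using this

/-- A binary number (least significant digit first) without superfluous zeros; `l` tells what to
answer for the empty word. -/
def canon : Bool → List Bool → Bool
  | l, [] => l
  | _, d :: ds => canon d ds

/-- The value of a binary number, least significant digit first. -/
def val : List Bool → ℕ
  | [] => 0
  | d :: ds => d.toNat + 2 * val ds

theorem spec_digits (s l : Bool) (x : List (InstSymbol α)) (I D : List (Sym α))
    {A : List Bool → List (InstSymbol α) → Prop} (hb : b s = tp D [])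
    (h : ∀ ds y I, x = ds.map .bit ++ .sep :: y → canon l ds = true →
      (machine α).Spec (conf (if s then .row else .digits true true) (tp I (y.map .inp)) w
        (if s then c.move .left else c) t
        (Function.update b s (tp ((ds.map dg).reverse ++ D) []))) B (A ds y)) :
    (machine α).Spec (conf (.digits s l) (tp I (x.map .inp)) w c t b)
      (x.length + B) (∃ ds y, x = ds.map .bit ++ .sep :: y ∧ canon l ds = true ∧ A ds y) := by
  induction x generalizing I l D b A with
  | nil =>
    refine (spec_none _ (by nofun) rfl).mono le_rfl ?_
    simp
  | cons a x ih =>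
    cases a with
    | tick =>
      refine (spec_none _ (by nofun) rfl).mono le_rfl ?_
      simp only [false_iff]
      rintro ⟨_ | _, y, hk, -⟩ <;> simp at hk
    | letter d =>
      refine (spec_none _ (by nofun) rfl).mono le_rfl ?_
      simp only [false_iff]
      rintro ⟨_ | _, y, hk, -⟩ <;> simp at hk
    | sep =>
      cases l with
      | false =>
        refine (spec_none _ (by nofun) (by cases s <;> rfl)).mono le_rfl ?_
        simp only [false_iff]
        rintro ⟨_ | _, y, hk, hc, -⟩
        · simp [canon] at hc
        · simp at hk
      | true =>
        have := h [] x (.inp .sep :: I) rfl rfl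
        rw [List.map_nil, List.reverse_nil, List.nil_append, ← hb, Function.update_eq_self] at this
        have h1 : A [] x ↔ (∃ ds y, InstSymbol.sep :: x = ds.map .bit ++ .sep :: y ∧
            canon true ds = true ∧ A ds y) := by
          constructor
          · exact fun h => ⟨[], x, rfl, rfl, h⟩
          · rintro ⟨_ | _, y, hk, -, hA⟩
            · simp at hk; exact hk ▸ hA
            · simp at hk
        cases s with
        | false =>
          refine (spec_one (.digits true true) (by nofun) rfl ?_).mono
            (b := B + 1) (A := A [] x) (by simp only [List.length_cons]; omega) h1
          simpa [tp_right] using this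
        | true =>
          refine (spec_one .row (by nofun) rfl ?_).mono
            (b := B + 1) (A := A [] x) (by simp only [List.length_cons]; omega) h1
          simpa [tp_right] using this
    | bit d =>
      have := ih d (dg d :: I) (dg d :: D) (b := Function.update b s (tp (dg d :: D) []))
        (A := fun ds y => A (d :: ds) y) (by simp) fun ds y I hx hc => by
          have := h (d :: ds) y I (by rw [hx]; rfl) hc
          simpa using this
      refine (spec_one (.digits s d) (by nofun) rfl (B := x.length + B)
        (A := ∃ ds y, x = ds.map .bit ++ .sep :: y ∧ canon d ds = true ∧ A (d :: ds) y) ?_).mono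
        (by simp only [List.length_cons]; omega) ?_
      · rw [act_on, hb]
        simpa [tp_right, tp_push] using this
      · constructor
        · rintro ⟨ds, y, hx, hc, hA⟩
          exact ⟨d :: ds, y, by rw [hx]; rfl, hc, hA⟩
        · rintro ⟨_ | ⟨d', ds⟩, y, hk, hc, hA⟩
          · simp at hk
          · simp at hk
            obtain ⟨rfl, hk⟩ := hk
            exact ⟨ds, y, hk, hc, hA⟩

/-- The width tape measures the row: one cell is guessed per mark passed on the way left. The marks
are kept, as every row needs them. -/
theorem spec_cells (j m : ℕ) (L : List (Sym α)) {A : List (Set α) → Prop}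
    (h : ∀ row : List (Set α), row.length = j →
      (machine α).Spec (conf .back i (tp [] (un (j + m))) c
        (tp ((row.map .cell).reverse ++ L) []) b) B (A row)) :
    (machine α).Spec (conf .cells i ((tp (un j) (un m)).move .left) c (tp L []) b)
      (j + 1 + B) (∃ row : List (Set α), row.length = j ∧ A row) := by
  induction j generalizing m L A with
  | zero =>
    have := h [] rfl
    refine (spec_one (B := B) .back (by nofun) rfl ?_).mono (by omega) (A := A []) ?_
    · simpa using this
    · simp
  | succ j ih =>
    have e : (tp (un (j + 1)) (un m) : Tape (Sym α)).move .left = tp (un j) (un (m + 1)) :=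
      tp_left _ _ _
    rw [e]
    refine (spec_range (ι := Set α) (B := j + 1 + B)
      (A := fun s => ∃ row : List (Set α), row.length = j ∧ A (s :: row))
      (fun _ => .cells) _ _ _ _ _ (by nofun) rfl fun s => ?_).mono ?_ ?_
    · have := ih (m + 1) (.cell s :: L) (A := fun row => A (s :: row)) fun row hr => by
        have := h (s :: row) (by simp [hr])
        rw [show j + 1 + m = j + (m + 1) by omega] at this
        simpa using this
      simpa [tp_push] using this
    · omega
    · constructor
      · rintro ⟨s, row, hr, hA⟩
        exact ⟨s :: row, by simp [hr], hA⟩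
      · rintro ⟨_ | ⟨s, row⟩, hr, hA⟩
        · simp at hr
        · exact ⟨s, row, by simpa using hr, hA⟩

theorem spec_back (j m : ℕ)
    (h : (machine α).Spec (conf .row i (tp (un (j + m)) []) (c.move .left) t b) B A) :
    (machine α).Spec (conf .back i (tp (un m) (un j)) c t b) (j + 1 + B) A := by
  induction j generalizing m with
  | zero =>
    refine (spec_one (B := B) .row (by nofun) rfl ?_).mono (by omega) Iff.rfl
    simpa using h
  | succ j ih =>
    have := ih (m + 1) (by rwa [show j + 1 + m = j + (m + 1) by omega] at h)
    refine (spec_one (B := j + 1 + B) .back (by nofun) rfl ?_).mono (by omega) Iff.rfl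
    have e : (tp (un m) (un (j + 1)) : Tape (Sym α)).move .right = tp (un (m + 1)) (un j) := rfl
    simpa [e] using this

/-- A row costs `2 * n + 3` steps: one for its header, `n + 1` for the cells and `n + 1` for
returning on the width tape. The count tape is used up and thus free to hold state indices later. -/
theorem spec_row (n j : ℕ) (L : List (Sym α)) {A : List (Bool × List (Set α)) → Prop}
    (h : ∀ rows : List (Bool × List (Set α)), rows.length = j → (∀ r ∈ rows, r.2.length = n) →
      (machine α).Spec (conf .rewind i (tp (un n) []) (tp [] [])
        ((tp ((flat rows).reverse ++ L) []).move .left) b) B (A rows)) :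
    (machine α).Spec (conf .row i (tp (un n) []) ((tp (un j) []).move .left) (tp L []) b)
      (j * (2 * n + 3) + 1 + B)
      (∃ rows : List (Bool × List (Set α)), rows.length = j ∧ (∀ r ∈ rows, r.2.length = n) ∧
        A rows) := by
  induction j generalizing L A with
  | zero =>
    have := h [] rfl (by simp)
    have e : ((tp (un 0) []).move .left : Tape (Sym α)) = tp [] [] := tp_blank_left
    rw [e]
    refine (spec_one (B := B) .rewind (by nofun) rfl ?_).mono (by omega) (A := A []) ?_
    · simpa [flat] using this
    · simp
  | succ j ih =>
    refine (spec_range (ι := Bool) (B := n + 1 + (n + 1 + (j * (2 * n + 3) + 1 + B)))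
      (A := fun d => ∃ row : List (Set α), row.length = n ∧
        ∃ rows : List (Bool × List (Set α)), rows.length = j ∧ (∀ r ∈ rows, r.2.length = n) ∧
          A ((d, row) :: rows))
      (fun _ => .cells) _ _ _ _ _ (by nofun) rfl fun d => ?_).mono ?_ ?_
    · have := spec_cells (i := i) (c := tp (un j) []) (b := b) n 0 (.head d :: L)
        (B := n + 1 + (j * (2 * n + 3) + 1 + B)) (A := fun row =>
          ∃ rows : List (Bool × List (Set α)), rows.length = j ∧ (∀ r ∈ rows, r.2.length = n) ∧
            A ((d, row) :: rows)) fun row hrow => by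
          refine spec_back (m := 0) n ?_
          refine ih _ fun rows hj hn => ?_
          have := h ((d, row) :: rows) (by simp [hj]) (by simpa [hrow] using hn)
          simpa [flat] using this
      have e := tp_erase (un j) (tk : Sym α)
      simpa [tp_push, e, List.replicate_succ] using this
    · ring_nf; omega
    · constructor
      · rintro ⟨d, row, hrow, rows, hj, hn, hA⟩
        exact ⟨(d, row) :: rows, by simp [hj], by simpa [hrow] using hn, hA⟩
      · rintro ⟨_ | ⟨⟨d, row⟩, rows⟩, hj, hn, hA⟩
        · simp at hj
        · simp only [List.mem_cons, forall_eq_or_imp] at hn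
          exact ⟨d, row, hn.1, rows, by simpa using hj, hn.2, hA⟩

/-! ### Moving in the table -/

theorem spec_skipRow (row : List (Set α)) (L : List (Sym α))
    (rows : List (Bool × List (Set α)))
    (h : (machine α).Spec (conf .skip i w (c.move .left)
      (tp ((row.map .cell).reverse ++ L) (flat rows)) b) B A) :
    (machine α).Spec (conf .skipRow i w c (tp L (row.map .cell ++ flat rows)) b)
      (row.length + 1 + B) A := by
  induction row generalizing L with
  | nil =>
    refine (spec_one (B := B) .skip (ai := (i.head, none)) (aw := (w.head, none))
      (ac := (c.head, some .left)) (at' := ((tp L (flat rows)).head, none))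
      (ab := keep fun s => (b s).head) (by nofun) ?_ ?_).mono
        (by simp only [List.length_nil]; omega) Iff.rfl
    · rcases rows with _ | ⟨r, rows⟩ <;> rfl
    · simpa using h
  | cons s row ih =>
    refine (spec_one .skipRow (by nofun) rfl (by
      simpa [tp_right] using ih (.cell s :: L) (by simpa using h))).mono
        (by simp only [List.length_cons]; omega) Iff.rfl

/-- An index beyond the last row leads to the blank behind the table, where the machine is stuck. A
row with `m` cells occupies `m + 1` symbols and takes `m + 2` steps, whence the factor 2. -/
theorem spec_skip (j : ℕ) (rows : List (Bool × List (Set α))) (L : List (Sym α))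
    (h : j < rows.length → (machine α).Spec (conf .run i w (tp [] [])
      (tp ((flat (rows.take j)).reverse ++ L) (flat (rows.drop j))) b) B A) :
    (machine α).Spec (conf .skip i w ((tp (un j) []).move .left) (tp L (flat rows)) b)
      (2 * (flat rows).length + 1 + B) (j < rows.length ∧ A) := by
  induction rows generalizing j L with
  | nil => exact (spec_none _ (by nofun) rfl).mono le_rfl (by simp)
  | cons r rows ih =>
    cases j with
    | zero =>
      have e : ((tp (un 0) []).move .left : Tape (Sym α)) = tp [] [] := tp_blank_left
      rw [e]
      refine (spec_one (B := B) .run (by nofun) rfl ?_).mono (by omega) (A := A) (by simp)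
      simpa [flat] using h (by simp)
    | succ j =>
      have e := tp_erase (un j) (tk : Sym α)
      have e' : (tp L (flat (r :: rows)) : Tape (Sym α)).move .right =
        tp (.head r.1 :: L) (r.2.map .cell ++ flat rows) := rfl
      refine (spec_one (B := r.2.length + 1 + (2 * (flat rows).length + 1 + B))
        (A := j < rows.length ∧ A) .skipRow (by nofun) rfl ?_).mono ?_ (by simp)
      · have := spec_skipRow (i := i) (w := w) (c := tp (un j) []) (b := b) r.2
          (.head r.1 :: L) rows (ih j _ fun hj => by
            simpa [flat] using h (by simpa using hj))
        simpa [e, e', List.replicate_succ] using this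
      · simp only [flat, List.flatMap_cons, List.length_append, List.length_cons, List.length_map]
        omega

/-- `Col a row k`: the first entry of `row` that contains `a` is the one with index `k`. -/
def Col (a : α) : List (Set α) → ℕ → Prop
  | [], _ => False
  | s :: _, 0 => a ∈ s
  | s :: row, k + 1 => a ∉ s ∧ Col a row k

/-- Every cell passed adds a mark to the count tape, which therefore holds the index of the next
state when the search succeeds. `hF` makes the search stop at the end of the row. -/
theorem spec_find (a : α) (row : List (Set α)) (j : ℕ) (L F : List (Sym α)) {A : ℕ → Prop}
    (hF : F = [] ∨ ∃ d F', F = .head d :: F')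
    (h : ∀ k L' R', L'.reverse ++ R' = L.reverse ++ (row.map .cell ++ F) →
      (machine α).Spec (conf .rewind i w (tp (un (j + k)) []) ((tp L' R').move .left) b) B (A k)) :
    (machine α).Spec (conf (.find a) i w (tp (un j) []) (tp L (row.map .cell ++ F)) b)
      (row.length + 1 + B) (i.head ≠ .blank ∧ ∃ k, Col a row k ∧ A k) := by
  induction row generalizing j L A with
  | nil =>
    refine (spec_none _ (by nofun) ?_).mono le_rfl ?_
    · rcases hF with rfl | ⟨d, F', rfl⟩ <;> rfl
    · simp [Col]
  | cons s row ih =>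
    by_cases hs : a ∈ s
    · by_cases hi : i.head = .blank
      · exact (spec_none _ (by nofun) (trans_find_blank hs hi)).mono le_rfl (by simp [hi])
      · refine (spec_one (A := A 0) (B := B) .rewind (by nofun)
          (trans_find_mem hs hi) ?_).mono (by simp only [List.length_cons]; omega) ?_
        · simpa [act_left] using h 0 L (.cell s :: (row.map .cell ++ F)) rfl
        · constructor
          · exact fun h0 => ⟨hi, 0, hs, h0⟩
          · rintro ⟨-, _ | k, hk, hA⟩
            · exact hA
            · exact absurd hs hk.1
    · have := ih (j + 1) (.cell s :: L) (A := fun k => A (k + 1)) fun k L' R' hLR => by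
        have := h (k + 1) L' R' (by simpa using hLR)
        rwa [show j + (k + 1) = j + 1 + k by omega] at this
      have e' : act (.cell s, some Dir.right) (tp L (.cell s :: (row.map .cell ++ F))) =
        tp (.cell s :: L) (row.map .cell ++ F) := rfl
      refine (spec_one (B := row.length + 1 + B) (.find a) (by nofun)
          (trans_find_notMem hs) (by simpa [e', tp_push, List.replicate_succ] using this)).mono
            (by simp only [List.length_cons]; omega) ?_
      constructor
      · rintro ⟨hi, k, hk, hA⟩
        exact ⟨hi, k + 1, ⟨hs, hk⟩, hA⟩
      · rintro ⟨hi, _ | k, hk, hA⟩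
        · exact absurd hk hs
        · exact ⟨hi, k, hk.2, hA⟩

/-! ### Binary counters -/

theorem spec_home (s : Bool) (m : Option Bool) (L R : List Bool)
    (hb : b s = (tp (L.map dg) (R.map dg)).move .left)
    (h : (machine α).Spec (conf (.borrow s m) i w c t
      (Function.update b s (tp [] ((L.reverse ++ R).map dg)))) B A) :
    (machine α).Spec (conf (.home s m) i w c t b) (L.length + 1 + B) A := by
  induction L generalizing R b with
  | nil =>
    refine (spec_one (B := B) (.borrow s m) (ai := (i.head, none)) (aw := (w.head, none))
      (ac := (c.head, none)) (at' := (t.head, none))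
      (ab := on (fun s => (b s).head) s ((b s).head, some .right)) (by nofun) ?_ ?_).mono
        (by simp only [List.length_nil]; omega) Iff.rfl
    · simp only [trans, hb]; rfl
    · rw [act_on, act_keep_move, hb]
      simpa using h
  | cons d L ih =>
    rw [List.map_cons, tp_left] at hb
    have := ih (d :: R) (b := Function.update b s ((tp (L.map dg) (dg d :: R.map dg)).move .left))
      (by simp) (by simpa using h)
    refine (spec_one (B := L.length + 1 + B) (.home s m) (ai := (i.head, none))
      (aw := (w.head, none)) (ac := (c.head, none)) (at' := (t.head, none))
      (ab := on (fun s => (b s).head) s ((b s).head, some .left)) (by nofun) ?_ ?_).mono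
        (by simp only [List.length_cons]; omega) Iff.rfl
    · simp only [trans, hb]; rfl
    · rw [act_on, act_keep_move, hb]
      simpa using this

/-- Low-order zeros become ones until a one is found and cleared. If all digits are zero, the blank
is reached and the machine is stuck, which yields `0 < val R`. The head stops inside the number, so
its digits are split anew into `L₁` and `R₁`. -/
theorem spec_borrow (s m : Bool) (L R : List Bool)
    (hb : b s = tp (L.map dg) (R.map dg))
    (h : ∀ L₁ R₁ R₂ : List Bool, L₁.reverse ++ R₁ = L.reverse ++ R₂ → R₂.length = R.length →
      val R₂ + 1 = val R → (machine α).Spec (conf (.next s (some m)) i w c t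
        (Function.update b s (tp (L₁.map dg) (R₁.map dg)))) B A) :
    (machine α).Spec (conf (.borrow s (some m)) i w c t b) (R.length + 1 + B)
      (0 < val R ∧ A) := by
  induction R generalizing L b with
  | nil =>
    exact (spec_none _ (by nofun) (by simp only [trans, hb]; rfl)).mono le_rfl (by simp [val])
  | cons d R ih =>
    cases d with
    | true =>
      have := h L (false :: R) (false :: R) rfl rfl (by simp [val]; omega)
      refine (spec_one (B := B) (A := A) (.next s (some m)) (ai := (i.head, none))
        (aw := (w.head, none)) (ac := (c.head, none)) (at' := (t.head, none))
        (ab := on (fun s => (b s).head) s (dg false, none)) (by nofun)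
        (by simp only [trans, hb]; rfl) ?_).mono
          (by simp only [List.length_cons]; omega) (by simp [val])
      have e : act (dg false, none) (tp (L.map dg) (dg true :: R.map dg) : Tape (Sym α)) =
        tp (L.map dg) (dg false :: R.map dg) := rfl
      rw [act_on, hb]
      simpa [e] using this
    | false =>
      have e : act (dg true, some .right) (tp (L.map dg) (dg false :: R.map dg) : Tape (Sym α)) =
        tp (dg true :: L.map dg) (R.map dg) := rfl
      have := ih (true :: L) (b := Function.update b s (tp (dg true :: L.map dg) (R.map dg)))
        (by simp) fun L₁ R₁ R₂ h₁ h₂ h₃ => by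
          have := h L₁ R₁ (true :: R₂) (by simpa using h₁) (by simp [h₂])
            (by simp [val]; omega)
          simpa using this
      refine (spec_one (B := R.length + 1 + B) (.borrow s (some m)) (ai := (i.head, none))
        (aw := (w.head, none)) (ac := (c.head, none)) (at' := (t.head, none))
        (ab := on (fun s => (b s).head) s (dg true, some .right)) (by nofun)
        (by simp only [trans, hb]; rfl) ?_).mono
          (by simp only [List.length_cons]; omega) (A := 0 < val R ∧ A) (by simp [val])
      rw [act_on, hb]
      simpa [e] using this

theorem spec_borrow_none (s : Bool) (L R : List Bool)
    (hb : b s = tp (L.map dg) (R.map dg))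
    (h : ∀ T, (machine α).Spec (conf (.next s none) i w c t (Function.update b s T)) B A) :
    (machine α).Spec (conf (.borrow s none) i w c t b) (R.length + 1 + B) (val R = 0 ∧ A) := by
  induction R generalizing L b with
  | nil =>
    refine (spec_one (B := B) (A := A) (.next s none) (ai := (i.head, none))
        (aw := (w.head, none)) (ac := (c.head, none)) (at' := (t.head, none))
        (ab := keep fun s => (b s).head) (by nofun)
        (by simp only [trans, hb]; rfl) ?_).mono
          (by simp only [List.length_nil]; omega) (by simp [val])
    simpa using h (b s)
  | cons d R ih =>
    cases d with
    | true =>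
      exact (spec_none _ (by nofun) (by simp only [trans, hb]; rfl)).mono le_rfl
        (by simp [val])
    | false =>
      have := ih (false :: L) (b := Function.update b s (tp (dg false :: L.map dg) (R.map dg)))
        (by simp) fun T => by simpa using h T
      refine (spec_one (B := R.length + 1 + B) (.borrow s none) (ai := (i.head, none))
        (aw := (w.head, none)) (ac := (c.head, none)) (at' := (t.head, none))
        (ab := on (fun s => (b s).head) s ((b s).head, some .right)) (by nofun)
        (by simp only [trans, hb]; rfl) ?_).mono
          (by simp only [List.length_cons]; omega) (A := val R = 0 ∧ A) (by simp [val])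
      rw [act_on, act_keep_move, hb]
      simpa [tp_right] using this

/-- The tape contains a binary number with at most `k` digits and the value `v`. -/
def IsNum (T : Tape (Sym α)) (k v : ℕ) : Prop :=
  ∃ L R : List Bool, T = tp (L.map dg) (R.map dg) ∧ (L.reverse ++ R).length ≤ k ∧
    val (L.reverse ++ R) = v

/-- Going home and borrowing take at most `k + 1` steps each. The digit count never grows, so `k`
bounds all later decrements too. -/
theorem spec_dec (s m : Bool) {k v : ℕ} (hb : IsNum (b s) k v)
    (h : ∀ T, IsNum T k (v - 1) →
      (machine α).Spec (conf (.next s (some m)) i w c t (Function.update b s T)) B A) :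
    (machine α).Spec (conf (.home s (some m)) i w c t
      (Function.update b s ((b s).move .left))) (2 * k + 2 + B) (0 < v ∧ A) := by
  obtain ⟨L, R, hT, hk, rfl⟩ := hb
  refine (spec_home s (some m) L R (by simp [hT]) (spec_borrow (B := B) (A := A) s m []
    (L.reverse ++ R) (by simp) fun L₁ R₁ R₂ h₁ h₂ h₃ => ?_)).mono ?_ Iff.rfl
  · have := h _ ⟨L₁, R₁, rfl, by rw [h₁]; simpa [h₂] using hk, by rw [h₁, ← h₃]; simp⟩
    simpa using this
  · simp only [List.length_append, List.length_reverse] at hk ⊢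
    omega

theorem spec_zero (s : Bool) {k v : ℕ} (hb : IsNum (b s) k v)
    (h : ∀ T, (machine α).Spec (conf (.next s none) i w c t (Function.update b s T)) B A) :
    (machine α).Spec (conf (.home s none) i w c t
      (Function.update b s ((b s).move .left))) (2 * k + 2 + B) (v = 0 ∧ A) := by
  obtain ⟨L, R, hT, hk, rfl⟩ := hb
  refine (spec_home s none L R (by simp [hT]) (spec_borrow_none (B := B) (A := A) s []
    (L.reverse ++ R) (by simp) fun T => ?_)).mono ?_ Iff.rfl
  · simpa using h T
  · simp only [List.length_append, List.length_reverse] at hk ⊢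
    omega

end Phases
end TwoBound

/-! ### Simulating the guessed automaton -/

namespace TwoBound

open Turing NTM

variable {α : Type}

/-- The machine accepts when it is in state `q` of the automaton described by `rows`, the remaining
input is the given word, and the number of words which it still has to count for the lower and for
the upper bound is `l` and `u`, respectively. -/
def RunOK (rows : List (Bool × List (Set α))) : ℕ → ℕ → ℕ → List (InstSymbol α) → Prop
  | l, u, _, [] => u = 0 ∧ l = 0
  | l, u, q, .letter a :: x => x ≠ [] ∧ ∃ r, rows[q]? = some r ∧
      ∃ k, Col a r.2 k ∧ k < rows.length ∧ RunOK rows l u k x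
  | l, u, q, .sep :: x => ∃ r, rows[q]? = some r ∧
      (r.1 = true ∧ (∃ m : Bool, 0 < u ∧ (m = true → 0 < l) ∧
        RunOK rows (l - m.toNat) (u - 1) 0 x) ∨
      r.1 = false ∧ (∃ m : Bool, (m = true → 0 < u) ∧ RunOK rows l (u - m.toNat) 0 x))
  | _, _, _, _ => False

theorem ne_blank_of_mem_flat {rows : List (Bool × List (Set α))} {x : Sym α}
    (hx : x ∈ flat rows) : x ≠ .blank := by
  rintro rfl
  simp [flat] at hx

theorem flat_split (rows : List (Bool × List (Set α))) {q : ℕ} (hq : q < rows.length) :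
    flat (rows.drop q) = .head rows[q].1 :: (rows[q].2.map .cell ++ flat (rows.drop (q + 1))) := by
  rw [List.drop_eq_getElem_cons hq]
  rfl

theorem flat_take_append (rows : List (Bool × List (Set α))) (q : ℕ) :
    flat (rows.take q) ++ flat (rows.drop q) = flat rows := by
  rw [flat, flat, ← List.flatMap_append, List.take_append_drop]
  rfl

section Phases

variable [Finite α] {i w c t : Tape (Sym α)} {b : Bool → Tape (Sym α)} {B : ℕ} {A : Prop}

theorem spec_next_some_true (s : Bool)
    (h : (machine α).Spec (conf (.home false (some false)) i w c t
      (Function.update b false ((b false).move .left))) B A) :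
    (machine α).Spec (conf (.next s (some true)) i w c t b) (B + 1) A := by
  refine spec_one (.home false (some false)) (by nofun) rfl ?_
  rw [act_on]
  simpa using h

theorem spec_next_some_false (s : Bool) (h : (machine α).Spec (conf .rewind i w c t b) B A) :
    (machine α).Spec (conf (.next s (some false)) i w c t b) (B + 1) A := by
  refine spec_one .rewind (by nofun) rfl ?_
  simpa using h

theorem spec_take (m : Bool) {k l u : ℕ} (hl : IsNum (b false) k l) (hu : IsNum (b true) k u)
    (h : ∀ b' : Bool → Tape (Sym α), IsNum (b' false) k (l - m.toNat) → IsNum (b' true) k (u - 1) →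
      (machine α).Spec (conf .rewind i w c t b') B A) :
    (machine α).Spec (conf (.home true (some m)) i w c t
      (Function.update b true ((b true).move .left))) (4 * k + 6 + B)
      (0 < u ∧ (m = true → 0 < l) ∧ A) := by
  cases m with
  | false =>
    refine (spec_dec (A := A) (B := B + 1) true false hu fun T hT =>
      spec_next_some_false _ (h _ ?_ ?_)).mono (by omega) (by simp)
    · simpa using hl
    · simpa using hT
  | true =>
    refine (spec_dec (A := 0 < l ∧ A) (B := 2 * k + 2 + (B + 1) + 1) true true hu fun T hT =>
      spec_next_some_true _ (spec_dec false false (by simpa using hl) fun T' hT' =>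
        spec_next_some_false _ (h _ ?_ ?_))).mono (by omega) (by simp)
    · simpa using hT'
    · simpa using hT

theorem spec_finish {k l u : ℕ} (hl : IsNum (b false) k l) (hu : IsNum (b true) k u) :
    (machine α).Spec (conf (.home true none) i w c t
      (Function.update b true ((b true).move .left))) (4 * k + 6) (u = 0 ∧ l = 0) := by
  refine (spec_zero (A := l = 0) (B := 2 * k + 2 + 1 + 1) true hu fun T => ?_).mono
    (by omega) Iff.rfl
  refine spec_one (.home false none) (by nofun) rfl ?_
  rw [act_on]
  have hl' : IsNum (Function.update b true T false) k l := by simpa using hl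
  have := spec_zero (i := i) (w := w) (c := c) (t := t) (A := True) (B := 1) false hl' fun T' => by
    refine spec_one .accept (by nofun) rfl ?_
    refine (Spec.of_halted 0 fun d hd => ?_).mono le_rfl (iff_true_intro rfl)
    unfold conf at hd
    obtain ⟨p, hp, -⟩ := step_iff.1 hd
    exact hp
  simpa using this

/-- With `F` the length of the table, rewinding costs at most `F + 1` steps and skipping at most `2
* F + 1`. -/
theorem spec_restart (rows : List (Bool × List (Set α))) (j : ℕ) (L R : List (Sym α))
    (hLR : L.reverse ++ R = flat rows)
    (h : j < rows.length → (machine α).Spec (conf .run i w (tp [] [])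
      (tp (flat (rows.take j)).reverse (flat (rows.drop j))) b) B A) :
    (machine α).Spec (conf .rewind i w (tp (un j) []) ((tp L R).move .left) b)
      (3 * (flat rows).length + 2 + B) (j < rows.length ∧ A) := by
  have hL : ∀ x ∈ L, x ≠ .blank := fun x hx => ne_blank_of_mem_flat (rows := rows) (by
    rw [← hLR]; simp [hx])
  have hlen : L.length ≤ (flat rows).length := by rw [← hLR]; simp
  refine (spec_rewind (B := 2 * (flat rows).length + 1 + B) L R hL ?_).mono (by omega) Iff.rfl
  rw [hLR]
  exact spec_skip j rows [] fun hj => by simpa using h hj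

/-- Per input symbol, a letter costs one search in a row and one restart; an end marker costs at
most two decrements and one restart. The factor of `x.length` dominates both. -/
theorem spec_run (rows : List (Bool × List (Set α))) (k : ℕ) (x : List (InstSymbol α))
    (I : List (Sym α)) (q l u : ℕ) (hq : q < rows.length)
    (hl : IsNum (b false) k l) (hu : IsNum (b true) k u) :
    (machine α).Spec (conf .run (tp I (x.map .inp)) w (tp [] [])
      (tp (flat (rows.take q)).reverse (flat (rows.drop q))) b)
      (x.length * (4 * (flat rows).length + 4 * k + 9) + (4 * k + 7)) (RunOK rows l u q x) := by
  induction x generalizing I q l u b with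
  | nil =>
    refine (spec_one (.home true none) (by nofun) rfl (B := 4 * k + 6) ?_).mono (by simp) Iff.rfl
    rw [act_on]
    simpa [RunOK] using spec_finish hl hu
  | cons s x ih =>
    have hr : rows[q]? = some rows[q] := List.getElem?_eq_getElem hq
    have hflat := flat_take_append rows q
    rw [flat_split rows hq] at hflat ⊢
    have hi : (tp I ((s :: x).map .inp)).move .right = tp (.inp s :: I) (x.map .inp) := rfl
    set V := x.length * (4 * (flat rows).length + 4 * k + 9) + (4 * k + 7) with hV
    have hV' : (s :: x).length * (4 * (flat rows).length + 4 * k + 9) + (4 * k + 7) =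
      V + (4 * (flat rows).length + 4 * k + 9) := by
      rw [hV, List.length_cons]; ring
    rw [hV']
    have restart : ∀ (b' : Bool → Tape (Sym α)) (l u : ℕ), IsNum (b' false) k l →
        IsNum (b' true) k u → (machine α).Spec (conf .rewind (tp (.inp s :: I) (x.map .inp)) w
          (tp [] []) ((tp (flat (rows.take q)).reverse
            (.head rows[q].1 :: (rows[q].2.map .cell ++ flat (rows.drop (q + 1))))).move .left) b')
          (3 * (flat rows).length + 2 + V) (RunOK rows l u 0 x) := fun b' l u hl hu => by
      have h0 : 0 < rows.length := by omega
      refine (spec_restart rows 0 _ _ (by simpa using hflat) fun _ =>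
        ih _ 0 l u h0 hl hu).mono le_rfl (by simp [h0])
    cases s with
    | tick => exact (spec_none _ (by nofun) rfl).mono le_rfl (by simp [RunOK])
    | bit d => exact (spec_none _ (by nofun) rfl).mono le_rfl (by simp [RunOK])
    | letter a =>
      have := spec_find (i := tp (.inp (.letter a) :: I) (x.map .inp)) (w := w) (b := b)
        (B := 3 * (flat rows).length + 2 + V) a rows[q].2 0
        (.head rows[q].1 :: (flat (rows.take q)).reverse) (flat (rows.drop (q + 1)))
        (A := fun k => k < rows.length ∧ RunOK rows l u k x) (by
          rcases rows.drop (q + 1) with _ | ⟨r, rs⟩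
          · exact .inl rfl
          · exact .inr ⟨r.1, _, rfl⟩) fun j L' R' h => by
          refine (spec_restart rows (0 + j) L' R' (by rw [h]; simpa using hflat) fun hj =>
            ih _ (0 + j) l u hj hl hu).mono le_rfl (by simp)
      have hlen : rows[q].2.length ≤ (flat rows).length := by
        rw [← hflat]; simp; omega
      refine (spec_one (.find a) (by nofun) rfl (by simpa [tp_right] using this)).mono
        (by omega) ?_
      have hx : (tp (.inp (.letter a) :: I) (x.map .inp)).head = Sym.blank ↔ x = [] := by
        cases x with
        | nil => exact iff_of_true rfl rfl
        | cons y x => exact iff_of_false (fun h => by cases h) (by simp)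
      simp [RunOK, hr, hx]
    | sep =>
      rcases hd : rows[q].1 with _ | _
      · rw [hd] at restart
        refine (spec_range (ι := Bool) (B := 4 * k + 6 + (3 * (flat rows).length + 2 + V))
          (A := fun m => (m = true → 0 < u) ∧ RunOK rows l (u - m.toNat) 0 x)
          (fun m => if m then .home true (some false) else .rewind) _ _ _ _ _ (by nofun) rfl
          fun m => ?_).mono (by omega) ?_
        · cases m with
          | false =>
            have := restart b l u hl hu
            simpa [tp_right, act_left] using this.mono (by omega) Iff.rfl
          | true =>
            simp only [if_true]
            rw [act_on]
            have := spec_take false hl hu fun b' hl hu => restart b' _ _ hl hu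
            simpa [tp_right, act_left] using this
        · simp [RunOK, hr, hd]
      · rw [hd] at restart
        refine (spec_range (ι := Bool) (B := 4 * k + 6 + (3 * (flat rows).length + 2 + V))
          (A := fun m => 0 < u ∧ (m = true → 0 < l) ∧ RunOK rows (l - m.toNat) (u - 1) 0 x)
          (fun m => .home true (some m)) _ _ _ _ _ (by nofun) rfl fun m => ?_).mono (by omega) ?_
        · rw [act_on]
          have := spec_take m hl hu fun b' hl hu => restart b' _ _ hl hu
          simpa [tp_right] using this
        · simp [RunOK, hr, hd]

end Phases
end TwoBound

/-! ### Canonical binary notation -/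

namespace TwoBound

open Turing NTM Computability

variable {α : Type}

theorem val_encodePosNum (p : PosNum) : val (encodePosNum p) = p := by
  induction p with
  | one => rfl
  | bit0 p ih => simp [encodePosNum, val, ih]; omega
  | bit1 p ih => simp [encodePosNum, val, ih]; omega

theorem canon_encodePosNum (l : Bool) (p : PosNum) : canon l (encodePosNum p) = true := by
  induction p generalizing l with
  | one => rfl
  | bit0 p ih => exact ih _
  | bit1 p ih => exact ih _

theorem exists_encodePosNum {d : Bool} {ds : List Bool} (h : canon d (d :: ds) = true) :
    ∃ p, encodePosNum p = d :: ds := by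
  induction ds generalizing d with
  | nil =>
    obtain rfl : d = true := h
    exact ⟨.one, rfl⟩
  | cons d' ds ih =>
    obtain ⟨p, hp⟩ := ih (d := d') h
    cases d
    · exact ⟨.bit0 p, by rw [← hp]; rfl⟩
    · exact ⟨.bit1 p, by rw [← hp]; rfl⟩

theorem encodeNat_coe (p : PosNum) : encodeNat p = encodePosNum p := by
  rw [encodeNat, PosNum.of_to_nat]
  rfl

theorem val_encodeNat (n : ℕ) : val (encodeNat n) = n := by
  conv_rhs => rw [← Num.to_of_nat n]
  rw [encodeNat]
  cases (n : Num) with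
  | zero => rfl
  | pos p => exact val_encodePosNum p

theorem canon_encodeNat (n : ℕ) : canon true (encodeNat n) = true := by
  rw [encodeNat]
  cases (n : Num) with
  | zero => rfl
  | pos p => exact canon_encodePosNum _ p

/-- Together with `canon_encodeNat`, this shows that the test of the last digit admits exactly the
words produced by `encodeNat`. -/
theorem encodeNat_val {ds : List Bool} (h : canon true ds = true) : encodeNat (val ds) = ds := by
  cases ds with
  | nil => rfl
  | cons d ds =>
    obtain ⟨p, hp⟩ := exists_encodePosNum (d := d) (ds := ds) h
    rw [← hp, val_encodePosNum, encodeNat_coe]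

theorem flat_length {rows : List (Bool × List (Set α))} {n : ℕ}
    (h : ∀ r ∈ rows, r.2.length = n) : (flat rows).length = rows.length * (n + 1) := by
  induction rows with
  | nil => simp [flat]
  | cons r rows ih =>
    simp only [List.mem_cons, forall_eq_or_imp] at h
    have := ih h.2
    simp only [flat, List.flatMap_cons, List.length_append, List.length_cons, List.length_map,
      h.1] at this ⊢
    rw [this]; ring

/-! ### Tables, automata and the language -/

theorem Col.unique {a : α} {row : List (Set α)} {k k' : ℕ} (h : Col a row k) (h' : Col a row k') :
    k = k' := by
  induction row generalizing k k' with
  | nil => exact h.elim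
  | cons s row ih =>
    rcases k with _ | k <;> rcases k' with _ | k'
    · rfl
    · exact absurd h h'.1
    · exact absurd h' h.1
    · rw [ih h.2 h'.2]

theorem col_of_getElem {a : α} {row : List (Set α)} {k : ℕ} (hk : k < row.length)
    (h : a ∈ row[k]) (h' : ∀ j (hj : j < k), a ∉ row[j]) : Col a row k := by
  induction row generalizing k with
  | nil => simp at hk
  | cons s row ih =>
    cases k with
    | zero => exact h
    | succ k =>
      refine ⟨h' 0 (by omega), ih (by simpa using hk) (by simpa using h) fun j hj => ?_⟩
      simpa using h' (j + 1) (by omega)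

open Classical in
theorem acceptedCount_cons {Q : Type} (A : DFA α Q) (w : List α) (ws : List (List α)) :
    A.acceptedCount (w :: ws : List (List α)) =
      (if A.evalFrom A.start w ∈ A.accept then 1 else 0) + A.acceptedCount (ws : List (List α)) := by
  unfold DFA.acceptedCount
  rw [← Multiset.cons_coe, Multiset.filter_cons, Multiset.card_add]
  congr 1
  change _ = if w ∈ A.accepts then 1 else 0
  split_ifs <;> rfl

/-- A list of words, as it is written in an instance. -/
def words (ws : List (List α)) : List (InstSymbol α) :=
  ws.flatMap fun w => w.map .letter ++ [.sep]

theorem words_cons (w : List α) (ws : List (List α)) :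
    words (w :: ws) = w.map .letter ++ .sep :: words ws := by
  simp [words]

/-- The row `r` of a transition table agrees with the automaton `A` at the state `q`. -/
def Agrees {N : ℕ} (A : DFA α (Fin N)) (q : Fin N) (r : Bool × List (Set α)) : Prop :=
  (r.1 = true ↔ q ∈ A.accept) ∧ ∀ a (k : Fin N), Col a r.2 k → A.step q a = k

open Classical in
-- The induction runs over single symbols, so a run may start inside a word: `w` is the rest of the
-- current word, read from `q`, and `ws` are the words after it.
theorem RunOK.exists_words {rows : List (Bool × List (Set α))} {A : DFA α (Fin rows.length)}
    (hA : ∀ q : Fin rows.length, Agrees A q rows[q]) (h0 : (A.start : ℕ) = 0)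
    {x : List (InstSymbol α)} {l u : ℕ} (q : Fin rows.length) (h : RunOK rows l u q x) :
    (x = [] ∧ l = 0 ∧ u = 0) ∨ ∃ w ws, x = words (w :: ws) ∧
      l ≤ (if A.evalFrom q w ∈ A.accept then 1 else 0) + A.acceptedCount (ws : List (List α)) ∧
      (if A.evalFrom q w ∈ A.accept then 1 else 0) + A.acceptedCount (ws : List (List α)) ≤ u ∧
      u ≤ ws.length + 1 := by
  induction x generalizing l u q with
  | nil => exact .inl ⟨rfl, h.2, h.1⟩
  | cons s x ih =>
    right
    have hr : rows[(q : ℕ)]? = some rows[q] := List.getElem?_eq_getElem q.2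
    cases s with
    | tick => exact h.elim
    | bit => exact h.elim
    | letter a =>
      obtain ⟨hx, r, hr', k, hk, hkn, hrun⟩ := h
      obtain rfl : rows[q] = r := Option.some.inj (hr.symm.trans hr')
      rcases ih ⟨k, hkn⟩ hrun with ⟨rfl, -⟩ | ⟨w, ws, rfl, hw⟩
      · exact absurd rfl hx
      · refine ⟨a :: w, ws, by simp [words_cons], ?_⟩
        rwa [DFA.evalFrom_cons, (hA q).2 a ⟨k, hkn⟩ hk]
    | sep =>
      have next : ∀ l u, RunOK rows l u 0 x → ∃ ws, x = words ws ∧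
          l ≤ A.acceptedCount (ws : List (List α)) ∧
          A.acceptedCount (ws : List (List α)) ≤ u ∧ u ≤ ws.length := fun l u h => by
        rw [← h0] at h
        rcases ih A.start h with ⟨rfl, rfl, rfl⟩ | ⟨w, ws, rfl, hw⟩
        · exact ⟨[], rfl, by simp [DFA.acceptedCount]⟩
        · exact ⟨w :: ws, rfl, by rwa [acceptedCount_cons]⟩
      obtain ⟨r, hr', h⟩ := h
      obtain rfl : rows[q] = r := Option.some.inj (hr.symm.trans hr')
      rcases h with ⟨hacc, m, hu, hl, h⟩ | ⟨hacc, m, hu, h⟩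
      · obtain ⟨ws, rfl, h1, h2, h3⟩ := next _ _ h
        refine ⟨[], ws, rfl, ?_⟩
        rw [DFA.evalFrom_nil, if_pos ((hA q).1.1 hacc)]
        cases m <;> simp at hl h1 <;> omega
      · obtain ⟨ws, rfl, h1, h2, h3⟩ := next _ _ h
        refine ⟨[], ws, rfl, ?_⟩
        rw [DFA.evalFrom_nil, if_neg fun h => Bool.false_ne_true (hacc.symm.trans ((hA q).1.2 h))]
        cases m <;> simp at hu h2 h3 <;> omega

open Classical in
theorem runOK_words {N : ℕ} {rows : List (Bool × List (Set α))} {A : DFA α (Fin N)}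
    (hN : rows.length = N) (hA : ∀ q : Fin N, ∃ r, rows[(q : ℕ)]? = some r ∧
      (r.1 = true ↔ q ∈ A.accept) ∧ ∀ a, Col a r.2 (A.step q a)) (h0 : (A.start : ℕ) = 0)
    (ws : List (List α)) {l u : ℕ} (hl : l ≤ A.acceptedCount (ws : List (List α)))
    (hu : A.acceptedCount (ws : List (List α)) ≤ u) (hu' : u ≤ ws.length) :
    RunOK rows l u 0 (words ws) := by
  induction ws generalizing l u with
  | nil =>
    simp only [DFA.acceptedCount, Multiset.coe_nil, Multiset.filter_zero, Multiset.card_zero,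
      nonpos_iff_eq_zero, List.length_nil] at hl hu'
    exact ⟨hu', hl⟩
  | cons w ws ih =>
    have hcard : A.acceptedCount (ws : List (List α)) ≤ ws.length :=
      Multiset.card_le_card (Multiset.filter_le _ _)
    rw [acceptedCount_cons] at hl hu
    rw [words_cons, ← h0]
    rw [List.length_cons] at hu'
    -- The inner induction on the word needs an arbitrary current state.
    generalize A.start = q at hl hu
    obtain ⟨r, hr, hacc, hcol⟩ := hA q
    induction w generalizing q r with
    | nil =>
      refine ⟨r, hr, ?_⟩
      rw [DFA.evalFrom_nil] at hl hu
      by_cases hq : q ∈ A.accept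
      · rw [if_pos hq] at hl hu
        refine .inl ⟨hacc.2 hq, ?_⟩
        -- The lower counter is decreased only when the remaining accepted words cannot exhaust it.
        by_cases hc : l ≤ A.acceptedCount (ws : List (List α))
        · exact ⟨false, by omega, by simp, ih (by simpa using hc) (by omega) (by omega)⟩
        · exact ⟨true, by omega, by omega, ih (by simp; omega) (by omega) (by omega)⟩
      · rw [if_neg hq] at hl hu
        refine .inr ⟨by simpa using mt hacc.1 hq, ?_⟩
        -- Slack is used only when forced, namely for `u = ws.length + 1`; then `hcard` keeps the
        -- upper bound valid.
        by_cases hc : u ≤ ws.length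
        · exact ⟨false, by simp, ih (by omega) (by simpa using hu) (by simpa using hc)⟩
        · exact ⟨true, by omega, ih (by omega) (by simp; omega) (by simp; omega)⟩
    | cons a w ihw =>
      rw [DFA.evalFrom_cons] at hl hu
      obtain ⟨r', hr', hacc', hcol'⟩ := hA (A.step q a)
      exact ⟨by simp, r, hr, _, hcol a, hN ▸ (A.step q a).2, ihw _ hl hu r' hr' hacc' hcol'⟩

theorem exists_agrees (rows : List (Bool × List (Set α))) (h : 0 < rows.length) :
    ∃ A : DFA α (Fin rows.length), (A.start : ℕ) = 0 ∧ ∀ q, Agrees A q rows[q] := by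
  classical
  -- A letter in no cell of a valid index gets the arbitrary target `q`; `Agrees` demands nothing
  -- there.
  refine ⟨⟨fun q a => if h : ∃ k : Fin rows.length, Col a rows[q].2 k then h.choose else q,
    ⟨0, h⟩, {q | rows[q].1 = true}⟩, rfl, fun q => ⟨Iff.rfl, fun a k hk => ?_⟩⟩
  have hex : ∃ k : Fin rows.length, Col a rows[q].2 k := ⟨k, hk⟩
  simp only [dif_pos hex]
  exact Fin.ext (hex.choose_spec.unique hk)

theorem exists_rows {n : ℕ} (A : DFA α (Fin n)) :
    ∃ rows : List (Bool × List (Set α)), rows.length = n ∧ (∀ r ∈ rows, r.2.length = n) ∧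
      ∀ q : Fin n, ∃ r, rows[(q : ℕ)]? = some r ∧ (r.1 = true ↔ q ∈ A.accept) ∧
        ∀ a, Col a r.2 (A.step q a) := by
  classical
  refine ⟨List.ofFn fun q : Fin n => (decide (q ∈ A.accept),
    List.ofFn fun j : Fin n => {a | A.step q a = j}), by simp, ?_, fun q =>
    ⟨_, by rw [List.getElem?_ofFn, dif_pos q.2], by simp, fun a => ?_⟩⟩
  · intro r hr
    obtain ⟨q, rfl⟩ := List.mem_ofFn.1 hr
    simp
  · refine col_of_getElem (by simp) (by simp) fun j hj => ?_
    rw [List.getElem_ofFn]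
    intro h
    have h : A.step q a = ⟨j, _⟩ := h
    simp [h] at hj

theorem mem_twoBoundDFA_iff (x : List (InstSymbol α)) : x ∈ twoBoundDFA α ↔
    ∃ n y, x = List.replicate n .tick ++ .sep :: y ∧
      ∃ ds y', y = ds.map .bit ++ .sep :: y' ∧ canon true ds = true ∧
      ∃ ds' y'', y' = ds'.map .bit ++ .sep :: y'' ∧ canon true ds' = true ∧
      ∃ rows : List (Bool × List (Set α)), rows.length = n ∧ (∀ r ∈ rows, r.2.length = n) ∧
        0 < rows.length ∧ RunOK rows (val ds) (val ds') 0 y'' := by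
  constructor
  · rintro ⟨⟨S, l, u, n, hlu, huS⟩, ⟨ws, rfl, rfl⟩, Q, _, A, hn, hl, hu⟩
    obtain ⟨n, rfl⟩ : ∃ m, n = m + 1 := Nat.exists_eq_succ_of_ne_zero (by
      rintro rfl
      exact (Fintype.card_eq_zero_iff.1 hn).false A.start)
    let e₀ := Fintype.equivFinOfCardEq hn
    -- The swap moves the start state to 0, where the machine begins each word.
    let e : Q ≃ Fin (n + 1) := e₀.trans (Equiv.swap (e₀ A.start) 0)
    have hacc : (DFA.reindex e A).acceptedCount ws = A.acceptedCount ws := by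
      have h : (DFA.reindex e A).accepts = A.accepts := DFA.accepts_reindex A e
      unfold DFA.acceptedCount
      rw [h]
    have h0 : ((DFA.reindex e A).start : ℕ) = 0 := by simp [e]
    obtain ⟨rows, hlen, hrow, hA⟩ := exists_rows (DFA.reindex e A)
    refine ⟨n + 1, _, ?_, encodeNat l, _, rfl, canon_encodeNat l, encodeNat u, words ws, rfl,
      canon_encodeNat u, rows, hlen, hrow, by omega, ?_⟩
    · simp [encodeTwoBound, words]
    · rw [val_encodeNat, val_encodeNat]
      exact runOK_words hlen hA h0 ws (hacc ▸ hl) (hacc ▸ hu) huS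
  · rintro ⟨_, _, rfl, ds, _, rfl, hds, ds', y, rfl, hds', rows, rfl, -, h0, hrun⟩
    obtain ⟨A, hA0, hA⟩ := exists_agrees rows h0
    obtain ⟨ws, rfl, h1, h2, h3⟩ : ∃ ws, y = words ws ∧
        val ds ≤ A.acceptedCount (ws : List (List α)) ∧
        A.acceptedCount (ws : List (List α)) ≤ val ds' ∧ val ds' ≤ ws.length := by
      rcases hrun.exists_words hA hA0 ⟨0, h0⟩ with ⟨rfl, hl, hu⟩ | ⟨w, ws, rfl, hw⟩
      · exact ⟨[], rfl, by simp [DFA.acceptedCount, hl, hu]⟩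
      · refine ⟨w :: ws, rfl, ?_⟩
        rw [acceptedCount_cons, show A.start = ⟨0, h0⟩ from Fin.ext hA0]
        exact hw
    refine ⟨⟨ws, val ds, val ds', rows.length, h1.trans h2, h3⟩, ⟨ws, rfl, ?_⟩, Fin rows.length,
      inferInstance, A, Fintype.card_fin _, h1, h2⟩
    simp [encodeTwoBound, encodeNat_val hds, encodeNat_val hds', words]

end TwoBound

/-! ### The whole computation -/

namespace TwoBound

open Turing NTM

variable {α : Type}

theorem isNum_digits (ds : List Bool) :
    IsNum (tp ((ds.map dg).reverse ++ []) [] : Tape (Sym α)) ds.length (val ds) :=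
  ⟨ds.reverse, [], by simp, by simp, by simp⟩

theorem IsNum.mono {T : Tape (Sym α)} {k k' v : ℕ} (h : IsNum T k v) (hk : k ≤ k') :
    IsNum T k' v := by
  obtain ⟨L, R, hT, hl, hv⟩ := h
  exact ⟨L, R, hT, hl.trans hk, hv⟩

variable [Finite α]

theorem init_eq (x : List (InstSymbol α)) : (machine α).init x =
    conf .ticks (tp [] (x.map .inp)) (tp [] []) (tp [] []) (tp [] []) (fun _ => tp [] []) := by
  refine NTM.Cfg.ext rfl (funext fun k => ?_)
  cases k <;> rfl

/-- A bound on the number of steps after the reading of the three numbers. -/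
def mainTime (N : ℕ) : ℕ :=
  N * (2 * N + 3) + 1 + (3 * (N * (N + 1)) + 2 +
    (N * (4 * (N * (N + 1)) + 4 * N + 9) + (4 * N + 7)))

/-- The number of states and both digit counts are at most `x.length`, so this single parameter
bounds every phase; the table has at most `x.length * (x.length + 1)` symbols. -/
theorem spec_init (x : List (InstSymbol α)) :
    (machine α).Spec ((machine α).init x) (3 * x.length + mainTime x.length)
      (x ∈ twoBoundDFA α) := by
  rw [init_eq, mem_twoBoundDFA_iff]
  refine (spec_ticks (B := 2 * x.length + mainTime x.length) x [] 0
    fun n y I hx => ?_).mono (by omega) Iff.rfl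
  have hx' : x.length = n + y.length + 1 := by rw [hx]; simp; omega
  refine (spec_digits (B := x.length + mainTime x.length) false true y I [] rfl
    fun ds y' I hy hds => ?_).mono (by omega) Iff.rfl
  have hy' : y.length = ds.length + y'.length + 1 := by rw [hy]; simp; omega
  refine (spec_digits (B := mainTime x.length) true true y' I [] (by simp)
    fun ds' y'' I hy hds' => ?_).mono (by omega) Iff.rfl
  have hy'' : y'.length = ds'.length + y''.length + 1 := by rw [hy]; simp; omega
  have hn : n ≤ x.length := by omega
  refine (spec_row (B := 3 * (x.length * (x.length + 1)) + 2 +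
    (x.length * (4 * (x.length * (x.length + 1)) + 4 * x.length + 9) + (4 * x.length + 7)))
    (0 + n) (0 + n) [] fun rows hlen hrow => ?_).mono (by rw [mainTime, zero_add]; gcongr)
      (by rw [zero_add])
  have hflat : (flat rows).length ≤ x.length * (x.length + 1) := by
    rw [flat_length hrow, hlen, zero_add]; gcongr
  refine (spec_restart rows 0 ((flat rows).reverse ++ []) [] (by simp) fun h0 =>
    spec_run rows x.length y'' I 0 (val ds) (val ds') h0 ?_ ?_).mono ?_ Iff.rfl
  · simpa using (isNum_digits (α := α) ds).mono (by omega)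
  · simpa using (isNum_digits (α := α) ds').mono (by omega)
  · gcongr
    omega

end TwoBound

theorem mainTheorem2 (α : Type) [Finite α] [Nonempty α] : InNP (twoBoundDFA α) := by
  refine ⟨TwoBound.machine α, 3 * Polynomial.X + (Polynomial.X * (2 * Polynomial.X + 3) + 1 +
    (3 * (Polynomial.X * (Polynomial.X + 1)) + 2 + (Polynomial.X *
      (4 * (Polynomial.X * (Polynomial.X + 1)) + 4 * Polynomial.X + 9) +
      (4 * Polynomial.X + 7)))), fun x => ?_⟩
  have h := TwoBound.spec_init x
  refine ⟨fun t c ht => (h.1 t c ht).trans (le_of_eq ?_), h.2⟩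
  simp [TwoBound.mainTime]
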